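/- A quasi-threshold graph is a finite graph obtained from isolated vertices by repeatedly adding a vertex adjacent to all existing vertices and taking disjoint unions of two such graphs. There is an algorithm (a single program for a random access machine, each elementary instruction or test costing one step) which, given a quasi-threshold graph $G$ with $n$ vertices and $m$ edges as a list of its edges, computes all Laplacian eigenvalues of $G$ (the eigenvalues of $L(G)=D(G)-A(G)$, all of which are nonnegative integers) with their multiplicities, in linear time: the number of steps is at most $C(n+m)$, and at most $C(m+1)$ if $G$ is connected, where $C$ is an absolute constant. -/

import Mathlib

/-! ## Quasi-threshold graphs -/

/-- The graph obtained from `G` by adding one new vertex `none`, adjacent to all vertices of `G`. -/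
def addUniversalVertex {V : Type} (G : SimpleGraph V) : SimpleGraph (Option V) :=
  SimpleGraph.fromRel fun x y =>
    match x, y with
    | some u, some v => G.Adj u v
    | none, some _ => True
    | _, none => False

/-- Quasi-threshold graphs, by their recursive definition: an isolated vertex is quasi-threshold;
adding a universal vertex to a quasi-threshold graph and taking the disjoint union of two
quasi-threshold graphs give quasi-threshold graphs. As usual, the class is closed under
isomorphism (the names of the vertices do not matter). -/
inductive IsQuasiThreshold : {V : Type} → SimpleGraph V → Prop
  | single : IsQuasiThreshold (⊥ : SimpleGraph Unit)
  | universal {V : Type} {G : SimpleGraph V} :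
      IsQuasiThreshold G → IsQuasiThreshold (addUniversalVertex G)
  | disjointUnion {V W : Type} {G : SimpleGraph V} {H : SimpleGraph W} :
      IsQuasiThreshold G → IsQuasiThreshold H → IsQuasiThreshold (G.sum H)
  | iso {V W : Type} {G : SimpleGraph V} {H : SimpleGraph W} :
      Nonempty (G ≃g H) → IsQuasiThreshold G → IsQuasiThreshold H

/-! ## Random access machines with a step count -/

namespace RAM

/-- A configuration of the machine: registers `reg 0, reg 1, …`, arrays `arr 0, arr 1, …`
(a program names only finitely many of both), the unread part of the read-only input tape,
and the content of the write-only output tape. -/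
structure State where
  reg : ℕ → ℕ
  arr : ℕ → ℕ → ℕ
  input : List ℕ
  output : List ℕ

/-- Before the computation all memory is zero, and the output tape is empty. -/
def State.init (w : List ℕ) : State where
  reg _ := 0
  arr _ _ := 0
  input := w
  output := []

/-- The elementary instructions. Registers and arrays are named by constants of the program;
only the position in an array is computed. The arithmetic consists of successor and predecessor
alone, so that a number in memory never exceeds the largest of the input numbers and the constants
of the program by more than the number of steps made: charging one step for an instruction hides
no arithmetic with long words. -/
inductive Instr
  /-- `reg x := k` -/
  | const (x k : ℕ)
  /-- `reg x := reg y` -/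
  | move (x y : ℕ)
  /-- `reg x := reg x + 1` -/
  | succ (x : ℕ)
  /-- `reg x := reg x - 1`, where `0 - 1 = 0` -/
  | pred (x : ℕ)
  /-- `reg x := arr a [reg y]` -/
  | load (x a y : ℕ)
  /-- `arr a [reg y] := reg x` -/
  | store (a y x : ℕ)
  /-- `reg x :=` the next input number (`0` at the end of the input) -/
  | read (x : ℕ)
  /-- append `reg x` to the output -/
  | write (x : ℕ)

/-- The effect of an elementary instruction. -/
def Instr.run : Instr → State → State
  | .const x k, s => { s with reg := Function.update s.reg x k }
  | .move x y, s => { s with reg := Function.update s.reg x (s.reg y) }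
  | .succ x, s => { s with reg := Function.update s.reg x (s.reg x + 1) }
  | .pred x, s => { s with reg := Function.update s.reg x (s.reg x - 1) }
  | .load x a y, s => { s with reg := Function.update s.reg x (s.arr a (s.reg y)) }
  | .store a y x, s =>
      { s with arr := Function.update s.arr a (Function.update (s.arr a) (s.reg y) (s.reg x)) }
  | .read x, s => { s with reg := Function.update s.reg x (s.input.headD 0), input := s.input.tail }
  | .write x, s => { s with output := s.output ++ [s.reg x] }

/-- Programs: elementary instructions combined by sequencing, branching and loops.
The tests compare two registers. -/
inductive Prog
  | instr (i : Instr)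
  | seq (p q : Prog)
  /-- `if reg x < reg y then p else q` -/
  | ifLt (x y : ℕ) (p q : Prog)
  /-- `while reg x < reg y do p` -/
  | whileLt (x y : ℕ) (p : Prog)

/-- `Exec p s t s'`: started in the configuration `s`, the program `p` halts in the configuration
`s'` after exactly `t` steps. Every execution of an elementary instruction and every evaluation of
a test is one step. -/
inductive Exec : Prog → State → ℕ → State → Prop
  | instr (i : Instr) (s : State) : Exec (.instr i) s 1 (i.run s)
  | seq {p q : Prog} {s₁ s₂ s₃ : State} {t₁ t₂ : ℕ} :
      Exec p s₁ t₁ s₂ → Exec q s₂ t₂ s₃ → Exec (.seq p q) s₁ (t₁ + t₂) s₃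
  | ifTrue {x y : ℕ} {p q : Prog} {s s' : State} {t : ℕ} :
      s.reg x < s.reg y → Exec p s t s' → Exec (.ifLt x y p q) s (1 + t) s'
  | ifFalse {x y : ℕ} {p q : Prog} {s s' : State} {t : ℕ} :
      ¬ s.reg x < s.reg y → Exec q s t s' → Exec (.ifLt x y p q) s (1 + t) s'
  | whileTrue {x y : ℕ} {p : Prog} {s₁ s₂ s₃ : State} {t₁ t₂ : ℕ} :
      s₁.reg x < s₁.reg y → Exec p s₁ t₁ s₂ → Exec (.whileLt x y p) s₂ t₂ s₃ →
      Exec (.whileLt x y p) s₁ (1 + t₁ + t₂) s₃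
  | whileFalse {x y : ℕ} {p : Prog} {s : State} :
      ¬ s.reg x < s.reg y → Exec (.whileLt x y p) s 1 s

end RAM

/-! ## Graphs as inputs -/

/-- The list `es` contains every edge of `G` exactly once, in any order, with its two endpoints
in any order. -/
structure IsEdgeList {n : ℕ} (G : SimpleGraph (Fin n)) (es : List (Fin n × Fin n)) : Prop where
  mem_iff : ∀ e : Sym2 (Fin n), e ∈ es.map (fun p => s(p.1, p.2)) ↔ e ∈ G.edgeSet
  nodup : (es.map fun p => s(p.1, p.2)).Nodup

/-- The input `n, m, u₁, v₁, …, uₘ, vₘ` for the vertex set `{0, …, n - 1}` and the list of edges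
`u₁v₁, …, uₘvₘ`. -/
def graphInput {n : ℕ} (es : List (Fin n × Fin n)) : List ℕ :=
  n :: es.length :: es.flatMap fun p => [(p.1 : ℕ), (p.2 : ℕ)]

/-! A quasi-threshold graph is the comparability graph of a rooted forest. A universal vertex
becomes a root above everything built so far, and a disjoint union puts two forests side by side.
With dep for the depth in the forest, the Laplacian satisfies charpoly(L) · ∏ (X - dep v - 1) = ∏ (X
- dep v) · ∏ (X - deg v - 1), so its spectrum is the multiset {dep v} + {deg v + 1} - {dep v + 1}.

The identity is proved by induction on the construction. Both sides are multiplicative under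
disjoint union. A universal vertex added to N vertices gives (X - 1) · charpoly(L') = X (X - 1 - N)
· charpoly(L)(X - 1). Here X and X - 1 come from the new depth 0 and X - N - 1 from the new degree
N, while the substitution of X - 1 accounts for all old depths and degrees growing by one.

The forest need not be built. An ancestor has at least the degree of a descendant, and adjacent
vertices of equal degree are twins, so any orientation of the edges along decreasing degrees gives
suitable depths. The program therefore counts degrees, then counts how often each vertex is the
lower end of an edge, and combines the three multisets in an array of counters. Correctness rests on
`IsQuasiThreshold.charpoly_lapMatrix_mul`, `depthCount_natEdges` and `runs_program`. -/

namespace Matrix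

/-! ### Characteristic polynomials of bordered matrices -/

open Polynomial

variable {R V : Type*} [CommRing R] [Fintype V] [DecidableEq V]

lemma charpoly_add_one (M : Matrix V V R) : (M + 1).charpoly = M.charpoly.comp (X - 1) := by
  have h := charpoly_sub_scalar M (-1)
  rw [map_neg, map_neg, map_one, map_one, sub_neg_eq_add, ← sub_eq_add_neg] at h
  exact h

/-- The characteristic polynomial of the Laplacian after adding a universal vertex, in terms of
bordered matrices. -/
lemma X_sub_one_mul_charpoly_bordered (M : Matrix V V R) (hM : ∀ j, ∑ i, M i j = 0) :
    (X - 1) * (fromBlocks (M + 1) (of fun _ (_ : Unit) => -1) (of fun (_ : Unit) _ => -1)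
      (of fun _ _ => (Fintype.card V : R))).charpoly =
    X * (X - 1 - C (Fintype.card V : R)) * M.charpoly.comp (X - 1) := by
  rw [← charpoly_add_one]
  -- Since the columns of the upper left block sum to X - 1, left multiplication by this triangular
  -- matrix clears the lower left block of the characteristic matrix.
  set T : Matrix (V ⊕ Unit) (V ⊕ Unit) R[X] :=
    fromBlocks 1 0 (of fun (_ : Unit) _ => -1) (of fun _ _ => X - 1) with hT
  have hdet : T.det = X - 1 := by
    rw [hT, det_fromBlocks_zero₁₂]
    simp
  have hcol : ∀ j, ∑ i, (M + 1).charmatrix i j = X - 1 := by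
    intro j
    simp only [charmatrix_apply, Finset.sum_sub_distrib, ← map_sum]
    simp [Finset.sum_add_distrib, hM, diagonal_apply, one_apply]
  rw [← hdet, charpoly, ← det_mul, charmatrix_fromBlocks, hT, fromBlocks_multiply]
  have h₁ : (of fun (_ : Unit) (_ : V) => (-1 : R[X])) * (M + 1).charmatrix +
      (of fun (_ _ : Unit) => (X - 1 : R[X])) * -(of fun (_ : Unit) (_ : V) => (-1 : R)).map C
        = 0 := by
    ext1 i j
    simp only [add_apply, mul_apply, of_apply, neg_apply, map_apply, zero_apply, ← Finset.mul_sum,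
      hcol]
    simp
  rw [h₁, det_fromBlocks_zero₂₁, charpoly, mul_comm]
  congr 1
  · rw [det_unique]
    simp [mul_apply]
    ring
  · simp

end Matrix

/-! ### Degrees, depths and Laplacians under the graph operations -/

namespace SimpleGraph

lemma addUniversalVertex_adj_some_some {V : Type} {G : SimpleGraph V} {u v : V} :
    (addUniversalVertex G).Adj (some u) (some v) ↔ G.Adj u v := by
  simp only [addUniversalVertex, fromRel_adj, ne_eq, Option.some.injEq]
  exact ⟨fun h => h.2.elim id fun h => h.symm, fun h => ⟨h.ne, .inl h⟩⟩

lemma addUniversalVertex_adj_none_some {V : Type} {G : SimpleGraph V} {v : V} :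
    (addUniversalVertex G).Adj none (some v) := by
  simp [addUniversalVertex, fromRel_adj]

lemma addUniversalVertex_adj_some_none {V : Type} {G : SimpleGraph V} {v : V} :
    (addUniversalVertex G).Adj (some v) none :=
  addUniversalVertex_adj_none_some.symm

variable {V W : Type} [Fintype V] [Fintype W]

/-- The number of neighbours of `v` with a smaller key. If keys are assigned along decreasing
degrees in a quasi-threshold graph, this is the depth of `v` in the underlying rooted forest. -/
def keyDepth (G : SimpleGraph V) [DecidableRel G.Adj] (key : V → ℕ) (v : V) : ℕ :=
  ∑ u, if G.Adj u v ∧ key u < key v then 1 else 0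

/-- An injective assignment of keys under which, of two adjacent vertices, the one with the
smaller key has at least the degree of the other one. -/
structure IsDegreeKey (G : SimpleGraph V) [DecidableRel G.Adj] (key : V → ℕ) : Prop where
  injective : Function.Injective key
  degree_le : ∀ u v, G.Adj u v → key u < key v → G.degree v ≤ G.degree u

lemma degree_eq_sum_adj (G : SimpleGraph V) [DecidableRel G.Adj] (v : V) :
    G.degree v = ∑ u, if G.Adj v u then 1 else 0 := by
  simpa using G.degree_eq_sum_if_adj (R := ℕ) v

lemma keyDepth_iso {G : SimpleGraph V} {H : SimpleGraph W} [DecidableRel G.Adj]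
    [DecidableRel H.Adj] (e : G ≃g H) (key : W → ℕ) (v : V) :
    G.keyDepth (key ∘ e) v = H.keyDepth key (e v) :=
  Fintype.sum_equiv e.toEquiv _ _ fun u => by
    simp only [RelIso.coe_fn_toEquiv, e.map_adj_iff, Function.comp]

lemma IsDegreeKey.comp_iso {G : SimpleGraph V} {H : SimpleGraph W} [DecidableRel G.Adj]
    [DecidableRel H.Adj] {key : W → ℕ} (h : H.IsDegreeKey key) (e : G ≃g H) :
    G.IsDegreeKey (key ∘ e) where
  injective := h.injective.comp e.injective
  degree_le u v huv hk := by
    rw [← e.degree_eq, ← e.degree_eq]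
    exact h.degree_le _ _ (e.map_adj_iff.2 huv) hk

lemma charpoly_lapMatrix_iso [DecidableEq V] [DecidableEq W] {G : SimpleGraph V}
    {H : SimpleGraph W} [DecidableRel G.Adj] [DecidableRel H.Adj] (e : G ≃g H) :
    (H.lapMatrix ℝ).charpoly = (G.lapMatrix ℝ).charpoly := by
  rw [← Matrix.charpoly_reindex e.toEquiv (G.lapMatrix ℝ)]
  congr 1
  ext i j
  change H.lapMatrix ℝ i j = G.lapMatrix ℝ (e.symm i) (e.symm j)
  simp [lapMatrix, degMatrix, Matrix.diagonal_apply, adjMatrix_apply, e.symm.map_adj_iff,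
    e.symm.degree_eq]

section Sum

variable {G : SimpleGraph V} {H : SimpleGraph W} [DecidableRel (G.sum H).Adj]

lemma degree_sum_inl [DecidableRel G.Adj] (v : V) : (G.sum H).degree (.inl v) = G.degree v := by
  rw [degree_eq_sum_adj, degree_eq_sum_adj, Fintype.sum_sum_type]
  simp

lemma degree_sum_inr [DecidableRel H.Adj] (w : W) : (G.sum H).degree (.inr w) = H.degree w := by
  rw [degree_eq_sum_adj, degree_eq_sum_adj, Fintype.sum_sum_type]
  simp

lemma keyDepth_sum_inl [DecidableRel G.Adj] (key : V ⊕ W → ℕ) (v : V) :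
    (G.sum H).keyDepth key (.inl v) = G.keyDepth (key ∘ Sum.inl) v := by
  rw [keyDepth, keyDepth, Fintype.sum_sum_type]
  simp

lemma keyDepth_sum_inr [DecidableRel H.Adj] (key : V ⊕ W → ℕ) (w : W) :
    (G.sum H).keyDepth key (.inr w) = H.keyDepth (key ∘ Sum.inr) w := by
  rw [keyDepth, keyDepth, Fintype.sum_sum_type]
  simp

lemma IsDegreeKey.sum_inl [DecidableRel G.Adj] {key : V ⊕ W → ℕ} (h : (G.sum H).IsDegreeKey key) :
    G.IsDegreeKey (key ∘ Sum.inl) where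
  injective := h.injective.comp Sum.inl_injective
  degree_le u v huv hk := by
    simpa only [degree_sum_inl] using h.degree_le (.inl u) (.inl v) (sum_adj_inl.2 huv) hk

lemma IsDegreeKey.sum_inr [DecidableRel H.Adj] {key : V ⊕ W → ℕ} (h : (G.sum H).IsDegreeKey key) :
    H.IsDegreeKey (key ∘ Sum.inr) where
  injective := h.injective.comp Sum.inr_injective
  degree_le u v huv hk := by
    simpa only [degree_sum_inr] using h.degree_le (.inr u) (.inr v) (sum_adj_inr.2 huv) hk

lemma charpoly_lapMatrix_sum [DecidableEq V] [DecidableEq W] [DecidableRel G.Adj]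
    [DecidableRel H.Adj] :
    ((G.sum H).lapMatrix ℝ).charpoly = (G.lapMatrix ℝ).charpoly * (H.lapMatrix ℝ).charpoly := by
  rw [← Matrix.charpoly_fromBlocks_zero₁₂ (M₂₁ := 0)]
  congr 1
  ext (i | i) (j | j) <;>
    simp [lapMatrix, degMatrix, Matrix.diagonal_apply, adjMatrix_apply, degree_sum_inl,
      degree_sum_inr]

end Sum

section Universal

variable {G : SimpleGraph V} [DecidableRel (addUniversalVertex G).Adj]

lemma degree_addUniversalVertex_some [DecidableRel G.Adj] (v : V) :
    (addUniversalVertex G).degree (some v) = G.degree v + 1 := by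
  rw [degree_eq_sum_adj, degree_eq_sum_adj, Fintype.sum_option, add_comm]
  simp [addUniversalVertex_adj_some_some, addUniversalVertex_adj_some_none]

lemma degree_addUniversalVertex_none :
    (addUniversalVertex G).degree none = Fintype.card V := by
  rw [degree_eq_sum_adj, Fintype.sum_option]
  simp [addUniversalVertex_adj_none_some]

lemma keyDepth_addUniversalVertex_none {key : Option V → ℕ} (hk : ∀ v, key none < key (some v)) :
    (addUniversalVertex G).keyDepth key none = 0 := by
  rw [keyDepth, Fintype.sum_option]
  simp [fun v => (hk v).not_gt]

lemma keyDepth_addUniversalVertex_some [DecidableRel G.Adj] {key : Option V → ℕ} (hk : ∀ v, key none < key (some v))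
    (v : V) : (addUniversalVertex G).keyDepth key (some v) = G.keyDepth (key ∘ some) v + 1 := by
  rw [keyDepth, keyDepth, Fintype.sum_option, add_comm]
  simp [addUniversalVertex_adj_some_some, addUniversalVertex_adj_none_some, hk]

lemma IsDegreeKey.of_addUniversalVertex [DecidableRel G.Adj] {key : Option V → ℕ}
    (h : (addUniversalVertex G).IsDegreeKey key) : G.IsDegreeKey (key ∘ some) where
  injective := h.injective.comp (Option.some_injective V)
  degree_le u v huv hk := by
    simpa only [degree_addUniversalVertex_some, add_le_add_iff_right] using
      h.degree_le (some u) (some v) (addUniversalVertex_adj_some_some.2 huv) hk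

open Polynomial in
lemma X_sub_one_mul_charpoly_lapMatrix_addUniversalVertex [DecidableRel G.Adj] [DecidableEq V] :
    (X - 1) * ((addUniversalVertex G).lapMatrix ℝ).charpoly =
      X * (X - 1 - C (Fintype.card V : ℝ)) * (G.lapMatrix ℝ).charpoly.comp (X - 1) := by
  rw [← Matrix.X_sub_one_mul_charpoly_bordered,
    ← Matrix.charpoly_reindex (Equiv.optionEquivSumPUnit V)]
  · congr 2
    ext (i | i) (j | j)
    · by_cases hij : i = j <;>
      simp [lapMatrix, degMatrix, adjMatrix_apply, hij, degree_addUniversalVertex_some,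
        addUniversalVertex_adj_some_some]
    · simp [lapMatrix, degMatrix, adjMatrix_apply, addUniversalVertex_adj_some_none]
    · simp [lapMatrix, degMatrix, adjMatrix_apply, addUniversalVertex_adj_none_some]
    · simp [lapMatrix, degMatrix, adjMatrix_apply, degree_addUniversalVertex_none]
  · intro j
    have h := congrFun (G.lapMatrix_mulVec_const_eq_zero (R := ℝ)) j
    simp only [Matrix.mulVec, dotProduct, mul_one, Pi.zero_apply] at h
    rw [← h]
    exact Finset.sum_congr rfl fun i _ => (G.isSymm_lapMatrix (R := ℝ)).apply j i

end Universal

/-- A transposition of two adjacent universal vertices is an automorphism. -/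
def swapUniversal [DecidableEq V] (G : SimpleGraph V) {u v : V} (hu : ∀ w, w ≠ u → G.Adj u w)
    (hv : ∀ w, w ≠ v → G.Adj v w) : G ≃g G where
  toEquiv := Equiv.swap u v
  map_rel_iff' {a b} := by
    have key : ∀ x y, G.Adj x y → G.Adj (Equiv.swap u v x) (Equiv.swap u v y) := by
      intro x y hxy
      have hne : Equiv.swap u v x ≠ Equiv.swap u v y := (Equiv.injective _).ne hxy.ne
      -- If one of the images is u or v, universality gives the adjacency; otherwise the swap fixes
      -- both x and y.
      by_cases hx : Equiv.swap u v x = u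
      · rw [hx] at hne ⊢; exact hu _ hne.symm
      by_cases hx' : Equiv.swap u v x = v
      · rw [hx'] at hne ⊢; exact hv _ hne.symm
      by_cases hy : Equiv.swap u v y = u
      · rw [hy] at hne ⊢; exact (hu _ hne).symm
      by_cases hy' : Equiv.swap u v y = v
      · rw [hy'] at hne ⊢; exact (hv _ hne).symm
      have aux : ∀ z, Equiv.swap u v z ≠ u → Equiv.swap u v z ≠ v → Equiv.swap u v z = z :=
        fun z h₁ h₂ => Equiv.swap_apply_of_ne_of_ne
          (fun h => h₂ (by rw [h, Equiv.swap_apply_left]))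
          (fun h => h₁ (by rw [h, Equiv.swap_apply_right]))
      rw [aux x hx hx', aux y hy hy']
      exact hxy
    refine ⟨fun h => ?_, key a b⟩
    simpa using key _ _ h

lemma swapUniversal_apply_left {U : Type} [DecidableEq U] {G : SimpleGraph U} {u v : U}
    (hu : ∀ w, w ≠ u → G.Adj u w) (hv : ∀ w, w ≠ v → G.Adj v w) :
    G.swapUniversal hu hv u = v :=
  Equiv.swap_apply_left u v

end SimpleGraph

/-! ### The spectral identity -/

open Polynomial SimpleGraph in
/-- An identity that determines the Laplacian spectrum of a quasi-threshold graph in terms of the degrees and of the depths in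
the underlying forest. -/
theorem IsQuasiThreshold.charpoly_lapMatrix_mul {V : Type} {G : SimpleGraph V}
    (hG : IsQuasiThreshold G) : ∀ [Fintype V] [DecidableEq V] [DecidableRel G.Adj] (key : V → ℕ),
      G.IsDegreeKey key →
      (G.lapMatrix ℝ).charpoly * ∏ v, (X - C (G.keyDepth key v : ℝ) - 1) =
        (∏ v, (X - C (G.keyDepth key v : ℝ))) * ∏ v, (X - C (G.degree v : ℝ) - 1) := by
  induction hG with
  | single =>
    intro i₁ i₂ i₃ key _
    obtain rfl : i₁ = PUnit.instUnique.fintype := Subsingleton.elim _ _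
    have hL : (⊥ : SimpleGraph Unit).lapMatrix ℝ = 0 := by
      ext i j
      simp [lapMatrix, degMatrix]
    rw [hL]
    simp [keyDepth]
  | @universal V G _ ih =>
    intro i₁ i₂ i₃ key hkey
    classical
    have : Fintype V := Fintype.ofInjective (some : V → Option V) (Option.some_injective V)
    obtain rfl : i₁ = instFintypeOption := Subsingleton.elim _ _
    obtain rfl : i₂ = Option.instDecidableEq := Subsingleton.elim _ _
    -- The case in which the new vertex has the smallest key, hence depth 0. An automorphism reduces
    -- the general case to it.
    have main : ∀ key : Option V → ℕ, (addUniversalVertex G).IsDegreeKey key →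
        (∀ v, key none < key (some v)) →
        ((addUniversalVertex G).lapMatrix ℝ).charpoly *
          ∏ v, (X - C ((addUniversalVertex G).keyDepth key v : ℝ) - 1) =
        (∏ v, (X - C ((addUniversalVertex G).keyDepth key v : ℝ))) *
          ∏ v, (X - C ((addUniversalVertex G).degree v : ℝ) - 1) := by
      intro key hkey hnone
      have h := congrArg (fun p : ℝ[X] => p.comp (X - 1))
        (ih (key ∘ some) hkey.of_addUniversalVertex)
      simp only [mul_comp, prod_comp, sub_comp, X_comp, C_comp, one_comp] at h
      have hu := X_sub_one_mul_charpoly_lapMatrix_addUniversalVertex (G := G)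
      simp only [Fintype.prod_option, keyDepth_addUniversalVertex_none hnone,
        keyDepth_addUniversalVertex_some hnone, degree_addUniversalVertex_some,
        degree_addUniversalVertex_none, Nat.cast_add, Nat.cast_one, Nat.cast_zero, map_add,
        map_one, map_zero, sub_zero]
      have e₁ : ∀ a : ℝ[X], X - (a + 1) = X - 1 - a := fun a => by ring
      simp only [e₁]
      linear_combination (∏ v, (X - 1 - C (G.keyDepth (key ∘ some) v : ℝ) - 1)) * hu +
        X * (X - 1 - C (Fintype.card V : ℝ)) * h
    -- Ties may give another vertex the smallest key. That vertex is adjacent to `none`, so its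
    -- degree is at least that of `none`, and it is universal too; swapping the two is an
    -- automorphism.
    obtain ⟨w, hw⟩ := Finite.exists_min key
    have hwu : ∀ x, x ≠ w → (addUniversalVertex G).Adj w x := by
      rcases w with _ | w
      · rintro (_ | x) hx
        · exact absurd rfl hx
        · exact addUniversalVertex_adj_none_some
      · have hd := hkey.degree_le (some w) none addUniversalVertex_adj_some_none
          ((hw none).lt_of_ne (hkey.injective.ne (by simp)))
        intro x hx
        by_contra hadj
        rw [degree_addUniversalVertex_none] at hd
        have hsub : (addUniversalVertex G).neighborFinset (some w) ⊆
            (Finset.univ.erase (some w)).erase x := by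
          intro y hy
          rw [mem_neighborFinset] at hy
          simp only [Finset.mem_erase, Finset.mem_univ, and_true]
          exact ⟨fun h => hadj (h ▸ hy), hy.ne'⟩
        have hc := Finset.card_le_card hsub
        have hpos : 0 < ((Finset.univ : Finset (Option V)).erase (some w)).card :=
          Finset.card_pos.2 ⟨x, by simpa using hx⟩
        rw [Finset.card_erase_of_mem (by simpa using hx), card_neighborFinset_eq_degree] at hc
        rw [Finset.card_erase_of_mem (Finset.mem_univ _), Finset.card_univ,
          Fintype.card_option] at hc hpos
        omega
    have hnu : ∀ x, x ≠ none → (addUniversalVertex G).Adj none x := by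
      rintro (_ | x) hx
      · exact absurd rfl hx
      · exact addUniversalVertex_adj_none_some
    let e := (addUniversalVertex G).swapUniversal hnu hwu
    have he : e none = w := swapUniversal_apply_left _ _
    have h := main (key ∘ e) (hkey.comp_iso e) fun v => by
      refine lt_of_le_of_ne ?_ ((hkey.injective.comp e.injective).ne (by simp))
      simp only [Function.comp, he]
      exact hw _
    simp only [keyDepth_iso] at h
    rwa [e.bijective.prod_comp (fun v => X - C ((addUniversalVertex G).keyDepth key v : ℝ) - 1),
      e.bijective.prod_comp (fun v => X - C ((addUniversalVertex G).keyDepth key v : ℝ))] at h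
  | @disjointUnion V W G H _ _ ihG ihH =>
    intro i₁ i₂ i₃ key hkey
    classical
    have : Fintype V := Fintype.ofInjective (Sum.inl : V → V ⊕ W) Sum.inl_injective
    have : Fintype W := Fintype.ofInjective (Sum.inr : W → V ⊕ W) Sum.inr_injective
    obtain rfl : i₁ = instFintypeSum V W := Subsingleton.elim _ _
    obtain rfl : i₂ = instDecidableEqSum := Subsingleton.elim _ _
    have hg := ihG _ hkey.sum_inl
    have hh := ihH _ hkey.sum_inr
    simp only [Fintype.prod_sum_type, keyDepth_sum_inl, keyDepth_sum_inr, degree_sum_inl,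
      degree_sum_inr, charpoly_lapMatrix_sum]
    rw [mul_mul_mul_comm, hg, hh]
    ring
  | @iso V W G H e _ ih =>
    intro i₁ i₂ i₃ key hkey
    classical
    obtain ⟨e⟩ := e
    have : Fintype V := Fintype.ofEquiv W e.toEquiv.symm
    have h := ih (key ∘ e) (hkey.comp_iso e)
    rw [charpoly_lapMatrix_iso e]
    simp only [keyDepth_iso, ← e.degree_eq] at h
    rwa [e.bijective.prod_comp (fun v => X - C (H.keyDepth key v : ℝ) - 1),
      e.bijective.prod_comp (fun v => X - C (H.keyDepth key v : ℝ)),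
      e.bijective.prod_comp (fun v => X - C (H.degree v : ℝ) - 1)] at h

open SimpleGraph in
-- All factors in the polynomial identity are products of monic linear polynomials, apart from the
-- characteristic polynomial itself, so comparing roots determines its roots.
theorem IsQuasiThreshold.roots_charpoly_lapMatrix {V : Type} {G : SimpleGraph V}
    (hG : IsQuasiThreshold G) [Fintype V] [DecidableEq V] [DecidableRel G.Adj] {key : V → ℕ}
    (hkey : G.IsDegreeKey key) :
    (((Finset.univ.val.map (G.keyDepth key) + Finset.univ.val.map fun v => G.degree v + 1) -
      Finset.univ.val.map fun v => G.keyDepth key v + 1).map fun k : ℕ => (k : ℝ)) =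
        (G.lapMatrix ℝ).charpoly.roots := by
  have h := congrArg Polynomial.roots (hG.charpoly_lapMatrix_mul key hkey)
  have hroots : ∀ f : V → ℕ, (∏ v, (Polynomial.X - Polynomial.C (f v : ℝ))).roots =
      (Finset.univ.val.map f).map fun k : ℕ => (k : ℝ) := by
    intro f
    rw [← Polynomial.roots_multiset_prod_X_sub_C
      ((Finset.univ.val.map f).map fun k : ℕ => (k : ℝ)), Multiset.map_map, Multiset.map_map]
    rfl
  have hne : ∀ f : V → ℕ, (∏ v, (Polynomial.X - Polynomial.C (f v : ℝ))) ≠ 0 := fun f =>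
    Finset.prod_ne_zero_iff.2 fun v _ => Polynomial.X_sub_C_ne_zero _
  have hshift : ∀ k : ℕ, (Polynomial.X - Polynomial.C (k : ℝ) - 1) =
      Polynomial.X - Polynomial.C ((k + 1 : ℕ) : ℝ) := fun k => by
    push_cast
    rw [map_add, map_one, sub_sub]
  simp only [hshift] at h
  rw [Polynomial.roots_mul (mul_ne_zero (Matrix.charpoly_monic _).ne_zero (hne _)),
    Polynomial.roots_mul (mul_ne_zero (hne _) (hne _)), hroots, hroots, hroots,
    ← Multiset.map_add] at h
  -- Multiset subtraction is truncated; the identity of roots shows that here nothing is lost.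
  have hle : (Finset.univ.val.map fun v => G.keyDepth key v + 1) ≤
      Finset.univ.val.map (G.keyDepth key) + Finset.univ.val.map fun v => G.degree v + 1 := by
    rw [← Multiset.map_le_map_iff (f := fun k : ℕ => (k : ℝ)) Nat.cast_injective, ← h]
    exact Multiset.le_add_left _ _
  rw [← tsub_add_cancel_of_le hle, Multiset.map_add] at h
  exact (add_right_cancel h).symm

/-! ### Rules for time-bounded execution -/

namespace RAM

/-- From the configuration `s`, the program `p` halts within `T` steps in a configuration
satisfying `Q`. -/
def Runs (p : Prog) (s : State) (T : ℕ) (Q : State → Prop) : Prop :=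
  ∃ t s', Exec p s t s' ∧ t ≤ T ∧ Q s'

lemma Runs.mono {p : Prog} {s : State} {T T' : ℕ} {Q Q' : State → Prop} (h : Runs p s T Q)
    (hT : T ≤ T') (hQ : ∀ s', Q s' → Q' s') : Runs p s T' Q' := by
  obtain ⟨t, s', he, ht, hs⟩ := h
  exact ⟨t, s', he, ht.trans hT, hQ s' hs⟩

lemma Runs.seq {p q : Prog} {s : State} {T₁ T₂ : ℕ} {Q R : State → Prop} (hp : Runs p s T₁ Q)
    (hq : ∀ s', Q s' → Runs q s' T₂ R) : Runs (.seq p q) s (T₁ + T₂) R := by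
  obtain ⟨t₁, s₁, he₁, ht₁, hs₁⟩ := hp
  obtain ⟨t₂, s₂, he₂, ht₂, hs₂⟩ := hq s₁ hs₁
  exact ⟨t₁ + t₂, s₂, .seq he₁ he₂, add_le_add ht₁ ht₂, hs₂⟩

lemma Runs.instr {i : Instr} {s : State} {Q : State → Prop} (h : Q (i.run s)) :
    Runs (.instr i) s 1 Q :=
  ⟨1, _, .instr i s, le_rfl, h⟩

lemma Runs.ifLt {x y : ℕ} {p q : Prog} {s : State} {T : ℕ} {Q : State → Prop}
    (hp : s.reg x < s.reg y → Runs p s T Q) (hq : ¬ s.reg x < s.reg y → Runs q s T Q) :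
    Runs (.ifLt x y p q) s (1 + T) Q := by
  by_cases h : s.reg x < s.reg y
  · obtain ⟨t, s', he, ht, hs⟩ := hp h
    exact ⟨1 + t, s', .ifTrue h he, by omega, hs⟩
  · obtain ⟨t, s', he, ht, hs⟩ := hq h
    exact ⟨1 + t, s', .ifFalse h he, by omega, hs⟩

/-- Straight-line code followed by a program. -/
def block : List Instr → Prog → Prog
  | [], p => p
  | i :: l, p => .seq (.instr i) (block l p)

lemma Runs.block {l : List Instr} {p : Prog} {s : State} {T : ℕ} {Q : State → Prop}
    (h : Runs p (l.foldl (fun s i => i.run s) s) T Q) : Runs (block l p) s (l.length + T) Q := by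
  induction l generalizing s with
  | nil => exact h.mono (by simp) fun _ => id
  | cons i l ih =>
    refine ((Runs.instr (Q := fun s' => s' = i.run s) rfl).seq fun s' hs' => ?_).mono
      (T := 1 + (l.length + T)) (by simp only [List.length_cons]; omega) fun _ => id
    subst hs'
    exact ih h

/-- A counting loop with an invariant and a cost for each round. -/
lemma Runs.whileLt {x y N : ℕ} {p : Prog} (Inv : ℕ → State → Prop) (c : ℕ → ℕ)
    (hreg : ∀ k s, Inv k s → s.reg x = k ∧ s.reg y = N)
    (hbody : ∀ k < N, ∀ s, Inv k s → Runs p s (c k) (Inv (k + 1))) {s : State} (hs : Inv 0 s) :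
    Runs (.whileLt x y p) s (∑ k ∈ Finset.range N, (c k + 1) + 1) (Inv N) := by
  -- Induction on the number d of remaining rounds, with an arbitrary current round k.
  suffices H : ∀ d k, k + d = N → ∀ s, Inv k s →
      Runs (.whileLt x y p) s (∑ j ∈ Finset.Ico k N, (c j + 1) + 1) (Inv N) by
    rw [Finset.range_eq_Ico]
    exact H N 0 (zero_add N) s hs
  intro d
  induction d with
  | zero =>
    intro k hk s hs
    obtain rfl : k = N := hk
    obtain ⟨h₁, h₂⟩ := hreg k s hs
    exact ⟨1, s, .whileFalse (by omega), by omega, hs⟩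
  | succ d ih =>
    intro k hk s hs
    obtain ⟨h₁, h₂⟩ := hreg k s hs
    obtain ⟨t₁, s₁, he₁, ht₁, hs₁⟩ := hbody k (by omega) s hs
    obtain ⟨t₂, s₂, he₂, ht₂, hs₂⟩ := ih (k + 1) (by omega) s₁ hs₁
    refine ⟨1 + t₁ + t₂, s₂, .whileTrue (by omega) he₁ he₂, ?_, hs₂⟩
    rw [Finset.sum_eq_sum_Ico_succ_bot (by omega)]
    omega

end RAM

/-! ## The program -/

namespace LaplacianProgram

open RAM

/-- The number of occurrences of `x` as an endpoint. -/
def degreeCount (E : List (ℕ × ℕ)) (x : ℕ) : ℕ :=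
  (E.map Prod.fst).count x + (E.map Prod.snd).count x

/-- The endpoint of smaller degree; in case of a tie, the one with the larger name. -/
def lowerEnd (E : List (ℕ × ℕ)) (e : ℕ × ℕ) : ℕ :=
  if degreeCount E e.1 < degreeCount E e.2 then e.1
  else if degreeCount E e.2 < degreeCount E e.1 then e.2
  else if e.1 < e.2 then e.2 else e.1

/-- The number of edges with lower endpoint `x`. -/
def depthCount (E : List (ℕ × ℕ)) (x : ℕ) : ℕ := (E.map (lowerEnd E)).count x

/-- The multiplicity of `k` among the depths, plus that among the successors of the degrees, minus
that among the successors of the depths. -/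
def multCount (n : ℕ) (E : List (ℕ × ℕ)) (k : ℕ) : ℕ :=
  ((List.range n).map (depthCount E)).count k +
    ((List.range n).map fun x => degreeCount E x + 1).count k -
    ((List.range n).map fun x => depthCount E x + 1).count k

/-- Add one to an entry of an array. -/
def incr (a x : ℕ) : List Instr := [.load 5 a x, .succ 5, .store a x 5]

/-- Read the edges, store them in arrays 3 and 4, and count the degrees in array 0. -/
def readBody : Prog :=
  block [.read 3, .read 4, .store 3 2 3, .store 4 2 4] <| block (incr 0 3) <| block (incr 0 4) <|
  .instr (.succ 2)

/-- Move the lower endpoint of the edge at the current position to register 3, and count it in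
array 1. -/
def depthBody : Prog :=
  block [.load 3 3 2, .load 4 4 2, .load 5 0 3, .load 6 0 4] <|
    .seq (.ifLt 5 6 (.instr (.move 3 3)) <|
      .ifLt 6 5 (.instr (.move 3 4)) <|
        .ifLt 3 4 (.instr (.move 3 4)) (.instr (.move 3 3))) <|
    block (incr 1 3) (.instr (.succ 2))

/-- Count the depth of the current vertex and the successor of its degree in array 2. -/
def addBody : Prog :=
  block [.load 3 1 2] <| block (incr 2 3) <| block [.load 3 0 2, .succ 3] <| block (incr 2 3) <|
  .instr (.succ 2)

/-- Count down the successor of the depth of the current vertex in array 2. -/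
def subBody : Prog :=
  block [.load 3 1 2, .succ 3, .load 5 2 3, .pred 5, .store 2 3 5] (.instr (.succ 2))

/-- Write the current number as often as array 2 says. -/
def writeBody : Prog :=
  block [.load 5 2 2, .const 3 0] <|
    .seq (.whileLt 3 5 (block [.write 2] (.instr (.succ 3)))) (.instr (.succ 2))

/-- The program that computes the Laplacian spectrum of a quasi-threshold graph. -/
def program : Prog :=
  block [.read 0, .read 1, .const 2 0] <| .seq (.whileLt 2 1 readBody) <|
  block [.const 2 0] <| .seq (.whileLt 2 1 depthBody) <|
  block [.const 2 0] <| .seq (.whileLt 2 0 addBody) <|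
  block [.const 2 0] <| .seq (.whileLt 2 0 subBody) <|
  -- The value n can be an eigenvalue, so the last loop must run through 0, …, n.
  block [.succ 0, .const 2 0] (.whileLt 2 0 writeBody)

variable (n : ℕ) (E : List (ℕ × ℕ))

/-- The state after `k` rounds of reading edges. -/
structure ReadInv (k : ℕ) (s : State) : Prop where
  reg_zero : s.reg 0 = n
  reg_one : s.reg 1 = E.length
  reg_two : s.reg 2 = k
  input : s.input = (E.drop k).flatMap fun e => [e.1, e.2]
  arr_zero : s.arr 0 = degreeCount (E.take k)
  edges : ∀ j e, j < k → E[j]? = some e → s.arr 3 j = e.1 ∧ s.arr 4 j = e.2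
  arr_one : s.arr 1 = fun _ => 0
  arr_two : s.arr 2 = fun _ => 0
  output : s.output = []

/-- The state after `k` rounds of comparing the endpoints of edges. -/
structure DepthInv (k : ℕ) (s : State) : Prop where
  reg_zero : s.reg 0 = n
  reg_one : s.reg 1 = E.length
  reg_two : s.reg 2 = k
  arr_zero : s.arr 0 = degreeCount E
  edges : ∀ j e, E[j]? = some e → s.arr 3 j = e.1 ∧ s.arr 4 j = e.2
  arr_one : s.arr 1 = fun x => ((E.take k).map (lowerEnd E)).count x
  arr_two : s.arr 2 = fun _ => 0
  output : s.output = []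

/-- The state after `k` rounds of counting depths and degrees. -/
structure AddInv (k : ℕ) (s : State) : Prop where
  reg_zero : s.reg 0 = n
  reg_two : s.reg 2 = k
  arr_zero : s.arr 0 = degreeCount E
  arr_one : s.arr 1 = depthCount E
  arr_two : s.arr 2 = fun x => ((List.range k).map (depthCount E)).count x +
    ((List.range k).map fun x => degreeCount E x + 1).count x
  output : s.output = []

/-- The state after `k` rounds of counting down. -/
structure SubInv (k : ℕ) (s : State) : Prop where
  reg_zero : s.reg 0 = n
  reg_two : s.reg 2 = k
  arr_one : s.arr 1 = depthCount E
  arr_two : s.arr 2 = fun x => ((List.range n).map (depthCount E)).count x +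
    ((List.range n).map fun x => degreeCount E x + 1).count x -
    ((List.range k).map fun x => depthCount E x + 1).count x
  output : s.output = []

/-- The state after writing the eigenvalues below `k`. -/
structure WriteInv (k : ℕ) (s : State) : Prop where
  reg_zero : s.reg 0 = n + 1
  reg_two : s.reg 2 = k
  arr_two : s.arr 2 = multCount n E
  output : s.output = (List.range k).flatMap fun j => List.replicate (multCount n E j) j

/-- The state after writing the eigenvalues below `k` and `j` copies of `k`. -/
structure WriteInnerInv (k j : ℕ) (s : State) : Prop where
  reg_zero : s.reg 0 = n + 1
  reg_two : s.reg 2 = k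
  reg_three : s.reg 3 = j
  reg_five : s.reg 5 = multCount n E k
  arr_two : s.arr 2 = multCount n E
  output : s.output = ((List.range k).flatMap fun j => List.replicate (multCount n E j) j) ++
    List.replicate j k

variable {n E}

/-! ### Loop bodies preserve their invariants -/

lemma runs_incr {a x : ℕ} {p : Prog} {s : State} {T : ℕ} {Q : State → Prop}
    (h : Runs p { s with
      reg := Function.update s.reg 5 (s.arr a (s.reg x) + 1)
      arr := Function.update s.arr a
        (Function.update (s.arr a) (s.reg x) (s.arr a (s.reg x) + 1)) } T Q)
    (hx : x ≠ 5) : Runs (block (incr a x) p) s (3 + T) Q :=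
  Runs.block (T := T) (by simpa [incr, Instr.run, hx] using h)

lemma update_incr (f : ℕ → ℕ) (a : ℕ) :
    Function.update f a (f a + 1) = fun x => f x + if x = a then 1 else 0 := by
  funext x
  by_cases h : x = a
  · subst h; simp
  · simp [h]

lemma count_singleton_eq (a x : ℕ) : [a].count x = if x = a then 1 else 0 := by
  grind

lemma runs_readBody {k : ℕ} (hk : k < E.length) {s : State} (h : ReadInv n E k s) :
    Runs readBody s 11 (ReadInv n E (k + 1)) := by
  refine Runs.block (T := 7) (runs_incr (T := 4) (runs_incr (T := 1) (Runs.instr ?_)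
    (by norm_num)) (by norm_num))
  have hin : s.input = E[k].1 :: E[k].2 :: (E.drop (k + 1)).flatMap fun e => [e.1, e.2] := by
    rw [h.input, List.drop_eq_getElem_cons hk]
    rfl
  constructor
  · simp [Instr.run, h.reg_zero]
  · simp [Instr.run, h.reg_one]
  · simp [Instr.run, h.reg_two]
  · simp [Instr.run, hin]
  · simp [Instr.run, hin, h.arr_zero]
    funext x
    rw [update_incr, update_incr]
    simp only [degreeCount, List.take_succ_eq_append_getElem hk, List.map_append,
      List.count_append, List.map_cons, List.map_nil, count_singleton_eq]
    ring
  · intro j e hj hje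
    have := h.edges j e
    simp [Instr.run, hin, h.reg_two, Function.update_apply]
    grind
  · simp [Instr.run, h.arr_one]
  · simp [Instr.run, h.arr_two]
  · simp [Instr.run, h.output]

/-- At most three tests and one move. The idle `move 3 3` lets all branches end in the same form. -/
lemma runs_lowerEnd {s : State} {u v : ℕ} (h₃ : s.reg 3 = u) (h₄ : s.reg 4 = v)
    (h₅ : s.reg 5 = degreeCount E u) (h₆ : s.reg 6 = degreeCount E v) :
    Runs (.ifLt 5 6 (.instr (.move 3 3)) <| .ifLt 6 5 (.instr (.move 3 4)) <|
        .ifLt 3 4 (.instr (.move 3 4)) (.instr (.move 3 3))) s 4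
      (fun s' => s' = { s with reg := Function.update s.reg 3 (lowerEnd E (u, v)) }) := by
  have skip : ∀ {r w : ℕ}, s.reg r = w → lowerEnd E (u, v) = w → ∀ T ≥ 1,
      Runs (.instr (.move 3 r)) s T
        (fun s' => s' = { s with reg := Function.update s.reg 3 (lowerEnd E (u, v)) }) := by
    intro r w hr hw T hT
    exact (Runs.instr (by rw [hw, ← hr]; rfl)).mono hT fun _ => id
  refine Runs.ifLt (T := 3) (fun h => ?_) fun h => Runs.ifLt (T := 2) (fun h' => ?_)
    fun h' => Runs.ifLt (T := 1) (fun h'' => ?_) fun h'' => ?_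
  all_goals rw [h₅, h₆] at h
  · exact skip h₃ (by simp [lowerEnd, h]) _ (by norm_num)
  all_goals rw [h₅, h₆] at h'
  · exact skip h₄ (by simp [lowerEnd, h, h']) _ (by norm_num)
  all_goals rw [h₃, h₄] at h''
  · exact skip h₄ (by simp [lowerEnd, h, h', h'']) _ (by norm_num)
  · exact skip h₃ (by simp [lowerEnd, h, h', h'']) _ (by norm_num)

lemma runs_depthBody {k : ℕ} (hk : k < E.length) {s : State} (h : DepthInv n E k s) :
    Runs depthBody s 12 (DepthInv n E (k + 1)) := by
  have he := h.edges k E[k] (List.getElem?_eq_getElem hk)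
  refine Runs.block (T := 8) (Runs.seq (T₁ := 4) (T₂ := 4)
    (runs_lowerEnd (E := E) (u := E[k].1) (v := E[k].2) ?_ ?_ ?_ ?_) ?_)
  · simp [Instr.run, h.reg_two, he]
  · simp [Instr.run, h.reg_two, he]
  · simp [Instr.run, h.reg_two, he, h.arr_zero]
  · simp [Instr.run, h.reg_two, he, h.arr_zero]
  rintro _ rfl
  refine runs_incr (T := 1) (Runs.instr ?_) (by norm_num)
  constructor
  · simp [Instr.run, h.reg_zero]
  · simp [Instr.run, h.reg_one]
  · simp [Instr.run, h.reg_two]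
  · simp [Instr.run, h.arr_zero]
  · intro j e hje
    simpa [Instr.run] using h.edges j e hje
  · simp [Instr.run, h.arr_one, -List.map_take]
    rw [update_incr (fun x => ((E.take k).map (lowerEnd E)).count x)]
    funext x
    simp only [List.take_succ_eq_append_getElem hk, List.map_append, List.count_append,
      List.map_cons, List.map_nil, count_singleton_eq]
  · simp [Instr.run, h.arr_two]
  · simp [Instr.run, h.output]

lemma runs_addBody {k : ℕ} {s : State} (h : AddInv n E k s) :
    Runs addBody s 10 (AddInv n E (k + 1)) := by
  refine Runs.block (T := 9) (runs_incr (T := 6) (Runs.block (T := 4) (runs_incr (T := 1)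
    (Runs.instr ?_) (by norm_num))) (by norm_num))
  constructor
  · simp [Instr.run, h.reg_zero]
  · simp [Instr.run, h.reg_two]
  · simp [Instr.run, h.arr_zero]
  · simp [Instr.run, h.arr_one]
  · simp [Instr.run, h.reg_two, h.arr_zero, h.arr_one, h.arr_two]
    funext x
    rw [update_incr, update_incr]
    simp only [List.range_succ, List.map_append, List.count_append, List.map_cons,
      List.map_nil, count_singleton_eq]
    ring
  · simp [Instr.run, h.output]

lemma runs_subBody {k : ℕ} {s : State} (h : SubInv n E k s) :
    Runs subBody s 6 (SubInv n E (k + 1)) := by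
  refine Runs.block (T := 1) (Runs.instr ?_)
  constructor
  · simp [Instr.run, h.reg_zero]
  · simp [Instr.run, h.reg_two]
  · simp [Instr.run, h.arr_one]
  -- Truncation is harmless for the invariant: a - b - 1 = a - (b + 1) also holds for truncated
  -- subtraction.
  · funext x
    simp [Instr.run, h.reg_two, h.arr_one, h.arr_two, Function.update_apply,
      List.range_succ, List.count_singleton]
    grind
  · simp [Instr.run, h.output]

/-- The cost is linear in the multiplicity of the current value, so the whole output loop costs n
plus the output length, up to constants. -/
lemma runs_writeBody {k : ℕ} {s : State} (h : WriteInv n E k s) :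
    Runs writeBody s (2 + (∑ _j ∈ Finset.range (multCount n E k), (2 + 1) + 1 + 1))
      (WriteInv n E (k + 1)) := by
  refine Runs.block (Runs.seq
    (Runs.whileLt (WriteInnerInv n E k) (fun _ => 2) (fun j s hs => ⟨hs.reg_three, hs.reg_five⟩)
      (fun j _ s hs => Runs.block (T := 1) (Runs.instr ?_)) ?_)
    fun s hs => Runs.instr ?_)
  · constructor
    · simp [Instr.run, hs.reg_zero]
    · simp [Instr.run, hs.reg_two]
    · simp [Instr.run, hs.reg_three]
    · simp [Instr.run, hs.reg_five]
    · simp [Instr.run, hs.arr_two]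
    · simp [Instr.run, hs.output, hs.reg_two, List.replicate_succ']
  · constructor
    · simp [Instr.run, h.reg_zero]
    · simp [Instr.run, h.reg_two]
    · simp [Instr.run]
    · simp [Instr.run, h.reg_two, h.arr_two]
    · simp [Instr.run, h.arr_two]
    · simp [Instr.run, h.output]
  · constructor
    · simp [Instr.run, hs.reg_zero]
    · simp [Instr.run, hs.reg_two]
    · simp [Instr.run, hs.arr_two]
    · simp [Instr.run, hs.output, List.range_succ]

/-- This holds for arbitrary lists of pairs; the output length stays in the bound until the list is
known to come from a graph. -/
lemma runs_program (n : ℕ) (E : List (ℕ × ℕ)) :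
    Runs program (State.init (n :: E.length :: E.flatMap fun e => [e.1, e.2]))
      (30 * (n + E.length + 1) + 3 * ∑ k ∈ Finset.range (n + 1), multCount n E k)
      (fun s => s.output =
        (List.range (n + 1)).flatMap fun j => List.replicate (multCount n E j) j) := by
  refine Runs.mono (Q := WriteInv n E (n + 1)) (Runs.block <| Runs.seq
    (Runs.whileLt (ReadInv n E) (fun _ => 11) (fun k s hs => ⟨hs.reg_two, hs.reg_one⟩)
      (fun k hk s hs => runs_readBody hk hs) ?_)
    fun s hs => Runs.block <| Runs.seq
    (Runs.whileLt (DepthInv n E) (fun _ => 12) (fun k s hs => ⟨hs.reg_two, hs.reg_one⟩)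
      (fun k hk s hs => runs_depthBody hk hs) ?_)
    fun s hs => Runs.block <| Runs.seq
    (Runs.whileLt (AddInv n E) (fun _ => 10) (fun k s hs => ⟨hs.reg_two, hs.reg_zero⟩)
      (fun k _ s hs => runs_addBody hs) ?_)
    fun s hs => Runs.block <| Runs.seq
    (Runs.whileLt (SubInv n E) (fun _ => 6) (fun k s hs => ⟨hs.reg_two, hs.reg_zero⟩)
      (fun k _ s hs => runs_subBody hs) ?_)
    fun s hs => Runs.block <|
      Runs.whileLt (WriteInv n E) _ (fun k s hs => ⟨hs.reg_two, hs.reg_zero⟩)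
      (fun k _ s hs => runs_writeBody hs) ?_) ?_ fun s hs => hs.output
  · constructor <;> simp [Instr.run, State.init]
    rfl
  · constructor
    · simp [Instr.run, hs.reg_zero]
    · simp [Instr.run, hs.reg_one]
    · simp [Instr.run]
    · simp [Instr.run, hs.arr_zero]
    · intro j e hje
      simpa [Instr.run] using hs.edges j e (List.getElem?_eq_some_iff.1 hje).1 hje
    · simp [Instr.run, hs.arr_one]
    · simp [Instr.run, hs.arr_two]
    · simp [Instr.run, hs.output]
  · constructor
    · simp [Instr.run, hs.reg_zero]
    · simp [Instr.run]
    · simp [Instr.run, hs.arr_zero]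
    · funext x
      simp [Instr.run, hs.arr_one, depthCount]
    · simp [Instr.run, hs.arr_two]
    · simp [Instr.run, hs.output]
  · constructor
    · simp [Instr.run, hs.reg_zero]
    · simp [Instr.run]
    · simp [Instr.run, hs.arr_one]
    · simp [Instr.run, hs.arr_two]
    · simp [Instr.run, hs.output]
  · constructor
    · simp [Instr.run, hs.reg_zero]
    · simp [Instr.run]
    · funext x
      simp [Instr.run, hs.arr_two, multCount]
    · simp [Instr.run, hs.output]
  · simp only [Finset.sum_const, Finset.card_range, smul_eq_mul, List.length_cons, List.length_nil,
      Finset.sum_add_distrib, ← Finset.sum_mul]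
    omega

end LaplacianProgram

/-! ## Correctness on quasi-threshold graphs -/

/-- Needed to absorb the additive constant of the running time into C(n + m). -/
lemma IsQuasiThreshold.nonempty {V : Type} {G : SimpleGraph V} (h : IsQuasiThreshold G) :
    Nonempty V := by
  induction h with
  | single => exact ⟨()⟩
  | universal => exact ⟨none⟩
  | disjointUnion _ _ ih => exact ih.map Sum.inl
  | iso e _ ih => exact ih.map e.some

lemma List.count_map_eq_sum {α β : Type*} [DecidableEq β] (l : List α) (f : α → β) (b : β) :
    (l.map f).count b = (l.map fun x => if f x = b then 1 else 0).sum := by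
  induction l with
  | nil => simp
  | cons x l ih => simp [List.count_cons, ih, add_comm]

lemma Finset.sum_list_sum_map {α β : Type*} (s : Finset α) (l : List β) (f : α → β → ℕ) :
    ∑ a ∈ s, (l.map (f a)).sum = (l.map fun b => ∑ a ∈ s, f a b).sum := by
  induction l with
  | nil => simp
  | cons x l ih => simp [Finset.sum_add_distrib, ih]

lemma Nat.mul_add_lt_mul_add_iff {n a b u v : ℕ} (hu : u < n) (hv : v < n) :
    a * n + u < b * n + v ↔ a < b ∨ a = b ∧ u < v := by
  rcases lt_trichotomy a b with h | rfl | h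
  · have := Nat.mul_le_mul_right n (Nat.succ_le_of_lt h)
    rw [Nat.succ_mul] at this
    exact iff_of_true (by omega) (.inl h)
  · simp
  · have := Nat.mul_le_mul_right n (Nat.succ_le_of_lt h)
    rw [Nat.succ_mul] at this
    exact iff_of_false (by omega) (by omega)

namespace IsEdgeList

variable {n : ℕ} {G : SimpleGraph (Fin n)} {es : List (Fin n × Fin n)}

lemma length_eq [DecidableRel G.Adj] (h : IsEdgeList G es) : es.length = G.edgeFinset.card := by
  have hL : (es.map fun p => s(p.1, p.2)).toFinset = G.edgeFinset := by
    ext e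
    rw [List.mem_toFinset, h.mem_iff, SimpleGraph.mem_edgeFinset]
  rw [← hL, List.toFinset_card_of_nodup h.nodup, List.length_map]

lemma fst_ne_snd (h : IsEdgeList G es) {p : Fin n × Fin n} (hp : p ∈ es) : p.1 ≠ p.2 := by
  have := (h.mem_iff s(p.1, p.2)).1 (List.mem_map_of_mem hp)
  rw [SimpleGraph.mem_edgeSet] at this
  exact this.ne

/-- Each edge is listed exactly once, so adjacency is a count in the list, and the two sums can be
exchanged. A trivial P yields degrees; comparison of keys yields depths. -/
lemma sum_adj [DecidableRel G.Adj] (h : IsEdgeList G es) (v : Fin n) (P : Fin n → Prop) [DecidablePred P] :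
    (∑ u, if G.Adj u v ∧ P u then 1 else 0) =
      (es.map fun p => ∑ u, if s(p.1, p.2) = s(u, v) ∧ P u then 1 else 0).sum := by
  rw [← Finset.sum_list_sum_map]
  refine Finset.sum_congr rfl fun u _ => ?_
  by_cases hP : P u
  · simp only [hP, and_true]
    rw [← List.count_map_eq_sum es (fun p => s(p.1, p.2)), h.nodup.count]
    simp only [h.mem_iff, SimpleGraph.mem_edgeSet]
  · simp [hP]

end IsEdgeList

/-- The edges as pairs of natural numbers. -/
def natEdges {n : ℕ} (es : List (Fin n × Fin n)) : List (ℕ × ℕ) :=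
  es.map fun p => ((p.1 : ℕ), (p.2 : ℕ))

lemma graphInput_eq {n : ℕ} (es : List (Fin n × Fin n)) :
    graphInput es =
      n :: (natEdges es).length :: (natEdges es).flatMap fun e => [e.1, e.2] := by
  simp [graphInput, natEdges, List.flatMap_map]

/-- The keys that order the vertices by decreasing degree and then by name. -/
def degreeKey {n : ℕ} (G : SimpleGraph (Fin n)) [DecidableRel G.Adj] (v : Fin n) : ℕ :=
  (n - G.degree v) * n + v

section

variable {n : ℕ} {G : SimpleGraph (Fin n)} [DecidableRel G.Adj] {es : List (Fin n × Fin n)}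

/-- Degrees are below n, so truncated subtraction from n reverses their order, and numbers with last
digit v in base n compare lexicographically. -/
lemma degreeKey_lt_iff {u v : Fin n} : degreeKey G u < degreeKey G v ↔
    G.degree v < G.degree u ∨ G.degree u = G.degree v ∧ u < v := by
  have hu := G.degree_lt_card_verts u
  have hv := G.degree_lt_card_verts v
  rw [Fintype.card_fin] at hu hv
  rw [degreeKey, degreeKey, Nat.mul_add_lt_mul_add_iff u.2 v.2, Fin.lt_def]
  omega

lemma isDegreeKey_degreeKey : G.IsDegreeKey (degreeKey G) where
  injective u v h := by
    have h₁ := h.not_lt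
    have h₂ := h.not_gt
    rw [degreeKey_lt_iff] at h₁ h₂
    rw [Fin.ext_iff]
    rw [Fin.lt_def] at h₁ h₂
    omega
  degree_le u v _ h := by
    rw [degreeKey_lt_iff] at h
    omega

open LaplacianProgram

lemma degreeCount_natEdges (h : IsEdgeList G es) (v : Fin n) :
    degreeCount (natEdges es) v = G.degree v := by
  have h₁ := h.sum_adj v (fun _ => True)
  simp only [and_true] at h₁
  rw [SimpleGraph.degree_eq_sum_adj]
  simp only [G.adj_comm v]
  rw [h₁, degreeCount, natEdges, List.map_map, List.map_map, List.count_map_eq_sum,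
    List.count_map_eq_sum, ← List.sum_map_add]
  refine congrArg List.sum (List.map_congr_left fun p hp => ?_)
  have hne := h.fst_ne_snd hp
  -- The endpoints differ, so at most one of the two orientations matches.
  have : ∀ u, (if s(p.1, p.2) = s(u, v) then 1 else 0) =
      (if p.1 = u then (if p.2 = v then 1 else 0) else 0) +
        if p.2 = u then (if p.1 = v then 1 else 0) else 0 := by
    intro u
    simp only [Sym2.eq_iff]
    grind
  simp only [this, Finset.sum_add_distrib, Finset.sum_ite_eq, Finset.mem_univ, if_true,
    Function.comp, Fin.val_inj]
  exact add_comm _ _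

lemma lowerEnd_natEdges (h : IsEdgeList G es) {a b : Fin n} (hab : a ≠ b) :
    lowerEnd (natEdges es) (a, b) = (if degreeKey G a < degreeKey G b then b else a : Fin n) := by
  have := Fin.val_ne_of_ne hab
  simp only [lowerEnd, degreeCount_natEdges h, degreeKey_lt_iff, Fin.lt_def]
  split_ifs <;> first | rfl | omega

/-- Each edge contributes one to the depth of its endpoint with the larger key, which is the lower
end chosen by the program. -/
lemma depthCount_natEdges (h : IsEdgeList G es) (v : Fin n) :
    depthCount (natEdges es) v = G.keyDepth (degreeKey G) v := by
  rw [SimpleGraph.keyDepth, h.sum_adj v fun u => degreeKey G u < degreeKey G v, depthCount,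
    natEdges, List.map_map, List.count_map_eq_sum]
  refine congrArg List.sum (List.map_congr_left fun p hp => ?_)
  have hne := h.fst_ne_snd hp
  have key : ∀ a b : Fin n, degreeKey G a < degreeKey G b →
      (∑ u, if s(a, b) = s(u, v) ∧ degreeKey G u < degreeKey G v then 1 else 0) =
        if b = v then 1 else 0 := by
    intro a b hab
    have : ∀ u, (if s(a, b) = s(u, v) ∧ degreeKey G u < degreeKey G v then 1 else 0) =
        if a = u then (if b = v then 1 else 0) else 0 := by
      intro u
      simp only [Sym2.eq_iff]
      grind
    simp only [this, Finset.sum_ite_eq, Finset.mem_univ, if_true]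
  have hl := lowerEnd_natEdges h hne
  rw [natEdges] at hl
  simp only [Function.comp, hl, Fin.val_inj]
  split_ifs with hlt
  · rw [key _ _ hlt]; simp_all
  · rw [key _ _ hlt]; simp_all
  · rw [Sym2.eq_swap, key _ _ (lt_of_le_of_ne (not_lt.1 hlt)
      (isDegreeKey_degreeKey.injective.ne hne.symm))]
    simp_all
  · rw [Sym2.eq_swap, key _ _ (lt_of_le_of_ne (not_lt.1 hlt)
      (isDegreeKey_degreeKey.injective.ne hne.symm))]
    simp_all

lemma coe_map_range (f : ℕ → ℕ) (g : Fin n → ℕ) (hfg : ∀ v : Fin n, f v = g v) :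
    ((List.range n).map f : Multiset ℕ) = Finset.univ.val.map g := by
  rw [← List.map_coe_finRange_eq_range, List.map_map]
  refine congrArg _ (List.map_congr_left fun v _ => hfg v)

lemma count_flatMap_replicate (c : ℕ → ℕ) (N k : ℕ) :
    ((List.range N).flatMap fun j => List.replicate (c j) j).count k =
      if k < N then c k else 0 := by
  induction N with
  | zero => simp
  | succ N ih =>
    rw [List.range_succ, List.flatMap_append, List.count_append, ih]
    simp only [List.flatMap_cons, List.flatMap_nil, List.append_nil, List.count_replicate]
    grind

lemma keyDepth_le_degree {V : Type} [Fintype V] (G : SimpleGraph V) [DecidableRel G.Adj]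
    (key : V → ℕ) (v : V) : G.keyDepth key v ≤ G.degree v := by
  rw [SimpleGraph.keyDepth, SimpleGraph.degree_eq_sum_adj]
  refine Finset.sum_le_sum fun u _ => ?_
  simp only [G.adj_comm v]
  split_ifs <;> simp_all

/-- The output of the program in terms of the multisets of depths and degrees. -/
lemma coe_flatMap_multCount (h : IsEdgeList G es) :
    (((List.range (n + 1)).flatMap fun j =>
      List.replicate (multCount n (natEdges es) j) j : List ℕ) : Multiset ℕ) =
    Finset.univ.val.map (G.keyDepth (degreeKey G)) +
      (Finset.univ.val.map fun v => G.degree v + 1) -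
      Finset.univ.val.map fun v => G.keyDepth (degreeKey G) v + 1 := by
  ext k
  rw [Multiset.coe_count, count_flatMap_replicate, Multiset.count_sub, Multiset.count_add,
    ← coe_map_range (depthCount (natEdges es)) _ (depthCount_natEdges h),
    ← coe_map_range (fun x => degreeCount (natEdges es) x + 1) _
      (fun v => by rw [degreeCount_natEdges h]),
    ← coe_map_range (fun x => depthCount (natEdges es) x + 1) _
      (fun v => by rw [depthCount_natEdges h]),
    Multiset.coe_count, Multiset.coe_count, Multiset.coe_count]
  split_ifs with hk
  · rfl
  -- Values above n do not occur: depths are at most degrees, and degrees are below n.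
  · have hdeg : ∀ x < n, degreeCount (natEdges es) x < n := fun x hx => by
      have := G.degree_lt_card_verts ⟨x, hx⟩
      rwa [Fintype.card_fin, ← degreeCount_natEdges h] at this
    have hdep : ∀ x < n, depthCount (natEdges es) x ≤ degreeCount (natEdges es) x := fun x hx => by
      have := keyDepth_le_degree G (degreeKey G) ⟨x, hx⟩
      rwa [← degreeCount_natEdges h, ← depthCount_natEdges h] at this
    rw [List.count_eq_zero_of_not_mem, List.count_eq_zero_of_not_mem, zero_add, zero_tsub]
    · intro hmem
      obtain ⟨x, hx, rfl⟩ := List.mem_map.1 hmem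
      have := hdeg x (List.mem_range.1 hx)
      omega
    · intro hmem
      obtain ⟨x, hx, rfl⟩ := List.mem_map.1 hmem
      have := hdeg x (List.mem_range.1 hx)
      have := hdep x (List.mem_range.1 hx)
      omega

/-- The sum is the output length. Discarding the subtracted multiset leaves 2n elements, which
suffices for a linear bound. -/
lemma sum_multCount_le (h : IsEdgeList G es) :
    ∑ k ∈ Finset.range (n + 1), multCount n (natEdges es) k ≤ 2 * n := by
  have hc := congrArg Multiset.card (coe_flatMap_multCount h)
  rw [Multiset.coe_card, List.length_flatMap] at hc
  simp only [List.length_replicate] at hc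
  refine (le_of_eq hc).trans ?_
  refine (Multiset.card_le_card (Multiset.sub_le_self _ _)).trans ?_
  simp
  omega

end

/-- One random access machine program computes, for every quasi-threshold graph with `n` vertices
and `m` edges, all Laplacian eigenvalues with their multiplicities (all of them are natural
numbers), in `O(n + m)` steps, hence in `O(m)` steps if the graph is connected. -/
theorem theorem8 :
    ∃ (P : RAM.Prog) (C : ℕ),
      ∀ (n : ℕ) (G : SimpleGraph (Fin n)) [DecidableRel G.Adj] (es : List (Fin n × Fin n)),
        IsQuasiThreshold G → IsEdgeList G es →
          ∃ (t : ℕ) (s : RAM.State),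
            RAM.Exec P (RAM.State.init (graphInput es)) t s ∧
            t ≤ C * (n + G.edgeFinset.card) ∧
            (G.Connected → t ≤ C * (G.edgeFinset.card + 1)) ∧
            Multiset.map (fun k : ℕ => (k : ℝ)) (s.output : Multiset ℕ) =
              (G.lapMatrix ℝ).charpoly.roots := by
  -- The time is at most 30(n + m + 1) + 6n ≤ 66(n + m) since n ≥ 1. A connected graph has n ≤ m +
  -- 1, which at most doubles the constant: 66(2m + 1) ≤ 132(m + 1).
  refine ⟨LaplacianProgram.program, 132, fun n G _ es hG h => ?_⟩
  obtain ⟨t, s, he, ht, hs⟩ := LaplacianProgram.runs_program n (natEdges es)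
  have hn : 0 < n := Fin.pos_iff_nonempty.2 hG.nonempty
  have hm : (natEdges es).length = G.edgeFinset.card := by
    rw [← h.length_eq, natEdges, List.length_map]
  have hsum := sum_multCount_le h
  rw [hm] at ht
  refine ⟨t, s, by rwa [graphInput_eq], by omega, fun hc => ?_, ?_⟩
  · have := hc.card_vert_le_card_edgeSet_add_one
    rw [Nat.card_eq_fintype_card, Nat.card_eq_fintype_card, Fintype.card_fin,
      ← SimpleGraph.edgeFinset_card] at this
    omega
  · rw [hs, coe_flatMap_multCount h]
    exact hG.roots_charpoly_lapMatrix isDegreeKey_degreeKey
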